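/- Let $P$ be a finite nonzero Borel measure on $\mathbb{R}^n$, and let $\lambda$ be Lebesgue measure on $\mathbb{R}^+=(0,\infty)$. For a random countable set $R \subseteq \mathbb{R}^+\times\mathbb{R}^n$ and a Borel set $B$, write $N(B)=\#(R\cap B)\in\{0,1,\dots,\infty\}$. The set $R$ is an exponential race with measure $P$ if (i) it is a Poisson process with mean measure $\lambda\times P$, that is, $N(B)\sim\mathrm{Poisson}((\lambda\times P)(B))$ for every Borel set $B$ (where $\mathrm{Poisson}(\infty)$ is the point mass at $\infty$), and $N(A_1),\dots,N(A_k)$ are independent for all disjoint Borel sets $A_1,\dots,A_k$; and (ii) almost surely it is totally ordered by its first coordinate (the time), i.e. no two of its points have the same time. Theorem. Let $R$ be an exponential race with measure $P$. Then almost surely the points of $R$ can be enumerated as an infinite sequence $(T_1,X^R_1),(T_2,X^R_2),\dots$ with $T_1<T_2<\cdots$, the point $(T_i,X^R_i)$ being the one preceded in time by exactly $i-1$ points of $R$. Moreover, for every $m$, if $X_1,\dots,X_m$ are i.i.d. with distribution $P(\cdot)/P(\mathbb{R}^n)$ and $E_1,\dots,E_m$ are i.i.d. exponential random variables with rate $P(\mathbb{R}^n)$,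 independent of $(X_1,\dots,X_m)$, then the first $m$ points $\{(T_i,X^R_i)\}_{i=1}^m$ of $R$ have the same joint distribution as $$\Big\{\Big(\sum_{j=1}^i E_j,\ X_i\Big)\Big\}_{i=1}^m .$$ -/

import Mathlib

open MeasureTheory ProbabilityTheory Set
open scoped ENNReal

/-- The Poisson distribution on `{0, 1, 2, …, ∞}` with rate `r ∈ [0, ∞]`. For finite `r` it is the
usual Poisson distribution, and for `r = ∞` it is the point mass at `∞`. -/
noncomputable def extPoisson (r : ℝ≥0∞) : Measure ℕ∞ :=
  if r = ∞ then Measure.dirac ⊤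
  else (poissonMeasure r.toNNReal).map (fun k : ℕ => (k : ℕ∞))

/-- A random countable set `R`, defined on the probability space `(Ω, μ)`, is a Poisson process
with (`σ`-finite, vanishing on singletons) mean measure `ν`: with `N(B) = #(R ∩ B)`, the number `N(B)` is a
random variable with distribution `Poisson(ν(B))` for every measurable `B`, and
`N(A_1), …, N(A_k)` are independent whenever `A_1, …, A_k` are measurable and disjoint. -/
structure IsPoissonProcess {Ω S : Type*} [MeasurableSpace Ω] [MeasurableSpace S]
    (R : Ω → Set S) (ν : Measure S) [SigmaFinite ν] [NullSingletonClass ν] (μ : Measure Ω) : Prop where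
  countable : ∀ᵐ ω ∂μ, (R ω).Countable
  hasLaw_count : ∀ B : Set S, MeasurableSet B →
    HasLaw (fun ω => (R ω ∩ B).encard) (extPoisson (ν B)) μ
  iIndepFun_count : ∀ (k : ℕ) (A : Fin k → Set S), (∀ j, MeasurableSet (A j)) →
    Pairwise (fun i j => Disjoint (A i) (A j)) →
    iIndepFun (fun (j : Fin k) ω => (R ω ∩ A j).encard) μ

/-- A random countable set `R ⊆ (0, ∞) × ℝⁿ` is an exponential race with measure `P`: it is a
Poisson process whose mean measure is the product of Lebesgue measure on `(0, ∞)` and `P`, and it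
is totally ordered by its first coordinate, the time (no two points share the same time). -/
structure IsExponentialRace {Ω : Type*} [MeasurableSpace Ω] {n : ℕ}
    (R : Ω → Set (ℝ × EuclideanSpace ℝ (Fin n)))
    (P : Measure (EuclideanSpace ℝ (Fin n))) [IsFiniteMeasure P] (μ : Measure Ω) : Prop where
  subset : ∀ᵐ ω ∂μ, R ω ⊆ Ioi 0 ×ˢ univ
  isPoissonProcess : IsPoissonProcess R ((volume.restrict (Ioi (0 : ℝ))).prod P) μ
  totallyOrdered : ∀ᵐ ω ∂μ, InjOn Prod.fst (R ω)

/-- `p` is the point of index `i` (counting from `0`) of the set `r` in the order of time: it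
belongs to `r` and exactly `i` points of `r` are strictly earlier. -/
def IsArrival {n : ℕ} (r : Set (ℝ × EuclideanSpace ℝ (Fin n))) (i : ℕ)
    (p : ℝ × EuclideanSpace ℝ (Fin n)) : Prop :=
  p ∈ r ∧ {q ∈ r | q.1 < p.1}.encard = i

open Classical in
/-- The point of index `i` (counting from `0`) of the set `r` in the order of time, with the
default value `0` when there is no such point. -/
noncomputable def arrival {n : ℕ} (r : Set (ℝ × EuclideanSpace ℝ (Fin n))) (i : ℕ) :
    ℝ × EuclideanSpace ℝ (Fin n) :=
  if h : ∃ p, IsArrival r i p then h.choose else 0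

/-! Write `c = P univ` and `ν` for the mean measure. Since `ν` is finite up to each time and
infinite in total, almost surely only finitely many points come before any given time and there are
infinitely many points in all. As times are distinct, the points are then listed by their number of
predecessors (`ae_isRaceSet`, `range_arrival`).

For the joint law, take times `0 = τ 0 ≤ … ≤ τ m ≤ u` and a set `D i` inside the `i`-th strip `(τ i,
τ (i + 1)] × ℝⁿ`. Consider the event that point `i` lies in `D i` for each `i < m` and that point
`m` comes after `u`. For the race this is an event about counts: one point in each `D i`, none in
the rest of its strip, none in `(τ m, u]`. Independence and the Poisson weights give `exp (-c u) * ∏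
ν (D i)` (`measure_arrival_mem`). For the partial sums, the weight `exp (c y)` turns the exponential
law into `c` times Lebesgue measure, and integrating out one step at a time gives the same value
(`measure_markedSum_mem`).

The time of point `m` is carried along because knowing only that the first `m` points lie in the
sets `D i` does not exclude further points in the last strip. Countably many rational strip systems
catch every strictly increasing sequence of positive times, so these events determine the law
(`ext_of_strips`). Projecting away the extra time finishes the proof. -/

/-! ### Deterministic sets of points ordered by time. -/

section RaceSet

variable {n : ℕ}

/-- A subset of `(0, ∞) × ℝⁿ` whose points have distinct times, with finitely many points up to
each time and infinitely many points in total. -/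
structure IsRaceSet (r : Set (ℝ × EuclideanSpace ℝ (Fin n))) : Prop where
  pos : ∀ p ∈ r, 0 < p.1
  injOn : InjOn Prod.fst r
  finite_le : ∀ t : ℝ, {p ∈ r | p.1 ≤ t}.Finite
  infinite : r.Infinite

namespace IsRaceSet

variable {r : Set (ℝ × EuclideanSpace ℝ (Fin n))}

lemma finite_lt (hr : IsRaceSet r) (t : ℝ) : {p ∈ r | p.1 < t}.Finite :=
  (hr.finite_le t).subset fun _ hp => ⟨hp.1, hp.2.le⟩

/-- Cutting `s` at the time of any one of its points leaves a finite set, whose minimum is global.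
-/
lemma exists_first (hr : IsRaceSet r) {s : Set (ℝ × EuclideanSpace ℝ (Fin n))} (hs : s ⊆ r)
    (hne : s.Nonempty) : ∃ p ∈ s, ∀ q ∈ s, p.1 ≤ q.1 := by
  obtain ⟨p, hp⟩ := hne
  have hfin : {q ∈ s | q.1 ≤ p.1}.Finite :=
    (hr.finite_le p.1).subset fun q hq => ⟨hs hq.1, hq.2⟩
  obtain ⟨a, ha, hmin⟩ := exists_min_image _ Prod.fst hfin ⟨p, hp, le_rfl⟩
  refine ⟨a, ha.1, fun q hq => ?_⟩
  rcases le_total q.1 p.1 with h | h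
  · exact hmin q ⟨hq, h⟩
  · exact ha.2.trans h

lemma _root_.IsArrival.index_le {i j : ℕ} {p q : ℝ × EuclideanSpace ℝ (Fin n)}
    (hp : IsArrival r i p) (hq : IsArrival r j q) (h : p.1 ≤ q.1) : i ≤ j := by
  have : {a ∈ r | a.1 < p.1}.encard ≤ {a ∈ r | a.1 < q.1}.encard :=
    encard_le_encard fun a ha => ⟨ha.1, ha.2.trans_le h⟩
  rw [hp.2, hq.2] at this
  exact_mod_cast this

lemma _root_.IsArrival.index_lt {i j : ℕ} {p q : ℝ × EuclideanSpace ℝ (Fin n)}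
    (hp : IsArrival r i p) (hq : IsArrival r j q) (h : p.1 < q.1) : i < j := by
  have h1 : insert p {a ∈ r | a.1 < p.1} ⊆ {a ∈ r | a.1 < q.1} := by
    rintro a (rfl | ha)
    · exact ⟨hp.1, h⟩
    · exact ⟨ha.1, ha.2.trans h⟩
  have h2 := encard_le_encard h1
  rw [encard_insert_of_notMem (fun h => lt_irrefl _ h.2), hp.2, hq.2] at h2
  exact_mod_cast h2

lemma isArrival_unique (hr : IsRaceSet r) {i : ℕ} {p q : ℝ × EuclideanSpace ℝ (Fin n)}
    (hp : IsArrival r i p) (hq : IsArrival r i q) : p = q := by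
  apply hr.injOn hp.1 hq.1
  rcases lt_trichotomy p.1 q.1 with h | h | h
  · exact absurd (hp.index_lt hq h) (lt_irrefl _)
  · exact h
  · exact absurd (hq.index_lt hp h) (lt_irrefl _)

/-- The next arrival is the earliest point among those later than the current one; distinct times
ensure that only the current point is added to the predecessors. -/
lemma exists_isArrival (hr : IsRaceSet r) (i : ℕ) : ∃ p, IsArrival r i p := by
  induction i with
  | zero =>
    obtain ⟨p, hp, hmin⟩ := hr.exists_first subset_rfl hr.infinite.nonempty
    refine ⟨p, hp, ?_⟩
    simp only [Nat.cast_zero, encard_eq_zero, eq_empty_iff_forall_notMem]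
    exact fun q hq => (hmin q hq.1).not_gt hq.2
  | succ i ih =>
    obtain ⟨p, hp⟩ := ih
    have hne : (r \ {q ∈ r | q.1 ≤ p.1}).Nonempty := (hr.infinite.sdiff (hr.finite_le p.1)).nonempty
    obtain ⟨q, hq, hmin⟩ := hr.exists_first sdiff_subset hne
    have hlt : p.1 < q.1 := by
      by_contra h
      exact hq.2 ⟨hq.1, not_lt.1 h⟩
    refine ⟨q, hq.1, ?_⟩
    have : {a ∈ r | a.1 < q.1} = insert p {a ∈ r | a.1 < p.1} := by
      ext a
      constructor
      · rintro ⟨ha, haq⟩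
        have hle : a.1 ≤ p.1 := by
          by_contra h
          exact (hmin a ⟨ha, fun h' => h h'.2⟩).not_gt haq
        rcases hle.eq_or_lt with h | h
        · exact Or.inl (hr.injOn ha hp.1 h)
        · exact Or.inr ⟨ha, h⟩
      · rintro (rfl | ha)
        · exact ⟨hp.1, hlt⟩
        · exact ⟨ha.1, ha.2.trans hlt⟩
    rw [this, encard_insert_of_notMem (fun h => lt_irrefl _ h.2), hp.2]
    norm_cast

lemma isArrival_arrival (hr : IsRaceSet r) (i : ℕ) : IsArrival r i (arrival r i) := by
  rw [arrival, dif_pos (hr.exists_isArrival i)]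
  exact (hr.exists_isArrival i).choose_spec

lemma arrival_mem (hr : IsRaceSet r) (i : ℕ) : arrival r i ∈ r := (hr.isArrival_arrival i).1

lemma arrival_eq (hr : IsRaceSet r) {i : ℕ} {p : ℝ × EuclideanSpace ℝ (Fin n)}
    (hp : IsArrival r i p) : arrival r i = p :=
  hr.isArrival_unique (hr.isArrival_arrival i) hp

lemma strictMono_arrival (hr : IsRaceSet r) : StrictMono fun i => (arrival r i).1 := by
  intro i j hij
  by_contra h
  exact hij.not_ge
    ((hr.isArrival_arrival j).index_le (hr.isArrival_arrival i) (not_lt.1 h))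

lemma arrival_injective (hr : IsRaceSet r) : Function.Injective (arrival r) :=
  Function.Injective.of_comp (f := Prod.fst) hr.strictMono_arrival.injective

lemma range_arrival (hr : IsRaceSet r) : range (arrival r) = r := by
  apply Subset.antisymm
  · rintro _ ⟨i, rfl⟩
    exact hr.arrival_mem i
  · intro p hp
    refine ⟨{q ∈ r | q.1 < p.1}.ncard, hr.arrival_eq ⟨hp, ?_⟩⟩
    exact (hr.finite_lt p.1).cast_ncard_eq.symm

/-- If the first points lie in given subsets of consecutive time strips, then each of these subsets
contains one point, and there is no other point up to a time before the next arrival. -/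
lemma encard_of_arrival_mem (hr : IsRaceSet r) {m : ℕ} {τ : ℕ → ℝ} (hτ : Monotone τ)
    {u : ℝ} (hu : τ m ≤ u)
    {D : ℕ → Set (ℝ × EuclideanSpace ℝ (Fin n))} (hD : ∀ i, D i ⊆ Ioc (τ i) (τ (i + 1)) ×ˢ univ)
    (h : ∀ i < m, arrival r i ∈ D i) (hm : u < (arrival r m).1) :
    (∀ i < m, (r ∩ D i).encard = 1 ∧ (r ∩ (Ioc (τ i) (τ (i + 1)) ×ˢ univ \ D i)).encard = 0) ∧
      (r ∩ Ioc (τ m) u ×ˢ univ).encard = 0 := by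
  have key : ∀ p ∈ r, p.1 ≤ u → ∃ j < m, arrival r j = p := by
    intro p hp hpu
    rw [← hr.range_arrival] at hp
    obtain ⟨j, rfl⟩ := hp
    exact ⟨j, hr.strictMono_arrival.lt_iff_lt.1 (hpu.trans_lt hm), rfl⟩
  have strip : ∀ i < m, ∀ p ∈ r, p.1 ∈ Ioc (τ i) (τ (i + 1)) → arrival r i = p := by
    intro i hi p hp hpi
    obtain ⟨j, hj, rfl⟩ := key p hp (hpi.2.trans ((hτ hi).trans hu))
    have hjD := (hD j (h j hj)).1
    rcases lt_trichotomy i j with hij | rfl | hij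
    · exact absurd (hpi.2.trans (hτ hij)) hjD.1.not_ge
    · rfl
    · exact absurd (hjD.2.trans (hτ hij)) hpi.1.not_ge
  refine ⟨fun i hi => ⟨?_, ?_⟩, ?_⟩
  · rw [encard_eq_one]
    refine ⟨arrival r i, Subset.antisymm (fun p hp => ?_) ?_⟩
    · exact (strip i hi p hp.1 (hD i hp.2).1).symm
    · rintro _ rfl
      exact ⟨hr.arrival_mem i, h i hi⟩
  · rw [encard_eq_zero, eq_empty_iff_forall_notMem]
    rintro p ⟨hp, hps, hpD⟩
    exact hpD (strip i hi p hp hps.1 ▸ h i hi)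
  · rw [encard_eq_zero, eq_empty_iff_forall_notMem]
    rintro p ⟨hp, hpu, -⟩
    obtain ⟨j, hj, rfl⟩ := key p hp hpu.2
    exact absurd ((hD j (h j hj)).1.2.trans (hτ hj)) hpu.1.not_ge

/-- Converse of `encard_of_arrival_mem`: with one point per strip, the number of predecessors of a
point is the index of its strip. -/
lemma arrival_mem_of_encard (hr : IsRaceSet r) {m : ℕ} {τ : ℕ → ℝ} (hτ : Monotone τ)
    (hτ0 : τ 0 = 0) {u : ℝ}
    {D : ℕ → Set (ℝ × EuclideanSpace ℝ (Fin n))} (hD : ∀ i, D i ⊆ Ioc (τ i) (τ (i + 1)) ×ˢ univ)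
    (h : ∀ i < m, (r ∩ D i).encard = 1 ∧
      (r ∩ (Ioc (τ i) (τ (i + 1)) ×ˢ univ \ D i)).encard = 0)
    (hm : (r ∩ Ioc (τ m) u ×ˢ univ).encard = 0) :
    (∀ i < m, arrival r i ∈ D i) ∧ u < (arrival r m).1 := by
  -- Peel off the last strip; at `k = 0` there is no such point because times are positive.
  have locate : ∀ k ≤ m, ∀ p ∈ r, p.1 ≤ τ k → ∃ j < k, p ∈ D j := by
    intro k
    induction k with
    | zero =>
      intro _ p hp hpk
      exact absurd (hr.pos p hp) (by rw [hτ0] at hpk; exact hpk.not_gt)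
    | succ k ih =>
      intro hk p hp hpk
      rcases le_or_gt p.1 (τ k) with hpk' | hpk'
      · obtain ⟨j, hj, hpj⟩ := ih (by omega) p hp hpk'
        exact ⟨j, by omega, hpj⟩
      · refine ⟨k, by omega, ?_⟩
        by_contra hpD
        have := (h k (by omega)).2
        rw [encard_eq_zero, eq_empty_iff_forall_notMem] at this
        exact this p ⟨hp, ⟨⟨hpk', hpk⟩, trivial⟩, hpD⟩
  have hone : ∀ i, ∃ p, i < m → r ∩ D i = {p} := fun i => by
    by_cases hi : i < m
    · obtain ⟨p, hp⟩ := encard_eq_one.1 (h i hi).1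
      exact ⟨p, fun _ => hp⟩
    · exact ⟨0, fun h => absurd h hi⟩
  choose p hp using hone
  have hpm : ∀ i < m, p i ∈ r ∧ p i ∈ D i := fun i hi => by
    have : p i ∈ r ∩ D i := by rw [hp i hi]; rfl
    exact this
  have hlt : ∀ i j, i < j → j < m → (p i).1 < (p j).1 := fun i j hij hj =>
    ((hD i (hpm i (hij.trans hj)).2).1.2.trans (hτ hij)).trans_lt (hD j (hpm j hj).2).1.1
  have hset : ∀ i < m, {q ∈ r | q.1 < (p i).1} = p '' Iio i := by
    intro i hi
    ext q
    constructor
    · rintro ⟨hq, hqi⟩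
      obtain ⟨j, hj, hqj⟩ := locate (i + 1) hi q hq
        (hqi.le.trans (hD i (hpm i hi).2).1.2)
      have hqp : q = p j := by
        have : q ∈ r ∩ D j := ⟨hq, hqj⟩
        rwa [hp j (by omega)] at this
      refine ⟨j, ?_, hqp.symm⟩
      rcases (Nat.lt_succ_iff.1 hj).lt_or_eq with h | rfl
      · exact h
      · rw [hqp] at hqi
        exact absurd hqi (lt_irrefl _)
    · rintro ⟨j, hj, rfl⟩
      exact ⟨(hpm j (lt_trans hj hi)).1, hlt j i hj hi⟩
  have harr : ∀ i < m, arrival r i = p i := by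
    intro i hi
    refine hr.arrival_eq ⟨(hpm i hi).1, ?_⟩
    rw [hset i hi, InjOn.encard_image]
    · rw [← Finset.coe_range, encard_coe_eq_coe_finsetCard, Finset.card_range]
    · intro a ha b hb hab
      rcases lt_trichotomy a b with h | h | h
      · exact absurd (congrArg Prod.fst hab) (hlt a b h (lt_trans hb hi)).ne
      · exact h
      · exact absurd (congrArg Prod.fst hab) (hlt b a h (lt_trans ha hi)).ne'
  refine ⟨fun i hi => harr i hi ▸ (hpm i hi).2, ?_⟩
  by_contra hle
  rw [not_lt] at hle
  rcases le_or_gt (arrival r m).1 (τ m) with h' | h'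
  · obtain ⟨j, hj, hjD⟩ := locate m le_rfl _ (hr.arrival_mem m) h'
    have : arrival r m ∈ r ∩ D j := ⟨hr.arrival_mem m, hjD⟩
    rw [hp j hj, mem_singleton_iff, ← harr j hj] at this
    exact hj.ne' (hr.arrival_injective this)
  · rw [encard_eq_zero, eq_empty_iff_forall_notMem] at hm
    exact hm _ ⟨hr.arrival_mem m, ⟨h', hle⟩, trivial⟩

lemma encard_inter_Iic (hr : IsRaceSet r) {i : ℕ} {t : ℝ} (h1 : ∀ j < i, (arrival r j).1 ≤ t)
    (h2 : t < (arrival r i).1) : (r ∩ Iic t ×ˢ univ).encard = i := by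
  have : r ∩ Iic t ×ˢ univ = arrival r '' Iio i := by
    ext p
    constructor
    · rintro ⟨hp, hpt, -⟩
      rw [← hr.range_arrival] at hp
      obtain ⟨j, rfl⟩ := hp
      exact ⟨j, hr.strictMono_arrival.lt_iff_lt.1 (lt_of_le_of_lt hpt h2), rfl⟩
    · rintro ⟨j, hj, rfl⟩
      exact ⟨hr.arrival_mem j, h1 j hj, trivial⟩
  rw [this, hr.arrival_injective.encard_image, ← Finset.coe_range,
    encard_coe_eq_coe_finsetCard, Finset.card_range]

/-- Membership of an arrival in a set, expressed through counts. -/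
lemma arrival_mem_iff (hr : IsRaceSet r) (i : ℕ) (D : Set (ℝ × EuclideanSpace ℝ (Fin n))) :
    arrival r i ∈ D ↔ ∃ q q' : ℚ, (r ∩ Iic (q : ℝ) ×ˢ univ).encard = i ∧
      (r ∩ Iic (q' : ℝ) ×ˢ univ).encard = (i + 1 : ℕ) ∧
      (r ∩ (Ioc (q : ℝ) q' ×ˢ univ ∩ D)).encard = 1 := by
  constructor
  · intro h
    -- `q` separates arrival `i` from the previous one, or from time `0` when `i = 0`; `q'`
    -- separates it from the next one.
    obtain ⟨q, hq1, hq2⟩ : ∃ q : ℚ, (∀ j < i, (arrival r j).1 ≤ q) ∧ (q : ℝ) < (arrival r i).1 := by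
      cases i with
      | zero =>
        obtain ⟨q, -, hq⟩ := exists_rat_btwn (hr.pos _ (hr.arrival_mem 0))
        exact ⟨q, by simp, hq⟩
      | succ i =>
        obtain ⟨q, hq, hq'⟩ := exists_rat_btwn (hr.strictMono_arrival (Nat.lt_succ_self i))
        exact ⟨q, fun j hj => (hr.strictMono_arrival.monotone (Nat.lt_succ_iff.1 hj)).trans hq.le,
          hq'⟩
    obtain ⟨q', hq1', hq2'⟩ := exists_rat_btwn (hr.strictMono_arrival (Nat.lt_succ_self i))
    refine ⟨q, q', hr.encard_inter_Iic hq1 hq2, hr.encard_inter_Iic (fun j hj =>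
      (hr.strictMono_arrival.monotone (Nat.lt_succ_iff.1 hj)).trans hq1'.le) hq2', ?_⟩
    rw [encard_eq_one]
    refine ⟨arrival r i, Subset.antisymm ?_ ?_⟩
    · rintro p ⟨hp, ⟨hpq, -⟩, -⟩
      rw [← hr.range_arrival] at hp
      obtain ⟨j, rfl⟩ := hp
      have hj : j < i + 1 := hr.strictMono_arrival.lt_iff_lt.1 (hpq.2.trans_lt hq2')
      have hj' : ¬ j < i := fun h => (hq1 j h).not_gt hpq.1
      rw [mem_singleton_iff, show j = i by omega]
    · rintro _ rfl
      exact ⟨hr.arrival_mem i, ⟨⟨hq2, hq1'.le⟩, trivial⟩, h⟩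
  · rintro ⟨q, q', hq, hq', h⟩
    obtain ⟨p, hp⟩ := encard_eq_one.1 h
    have hp' : p ∈ r ∩ (Ioc (q : ℝ) q' ×ˢ univ ∩ D) := by rw [hp]; rfl
    obtain ⟨hpr, ⟨hpq, -⟩, hpD⟩ := hp'
    have h1 : (i : ℕ∞) ≤ {a ∈ r | a.1 < p.1}.encard := by
      rw [← hq]
      exact encard_le_encard fun a ha => ⟨ha.1, lt_of_le_of_lt ha.2.1 hpq.1⟩
    have h2 : {a ∈ r | a.1 < p.1}.encard + 1 ≤ (i : ℕ∞) + 1 := by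
      rw [← encard_insert_of_notMem (a := p) (fun h => lt_irrefl _ h.2)]
      rw [Nat.cast_add, Nat.cast_one] at hq'
      rw [← hq']
      apply encard_le_encard
      rintro a (rfl | ha)
      · exact ⟨hpr, hpq.2, trivial⟩
      · exact ⟨ha.1, ha.2.le.trans hpq.2, trivial⟩
    have h3 : IsArrival r i p :=
      ⟨hpr, le_antisymm ((ENat.add_le_add_iff_right ENat.one_ne_top).1 h2) h1⟩
    rwa [hr.arrival_eq h3]

end IsRaceSet

end RaceSet

/-! ### The walk with exponential steps and independent marks. -/

/-- The weight `exp (c * y)` cancels the decay of the exponential density. -/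
lemma lintegral_mul_exp_expMeasure {c : ℝ} (hc : 0 < c) {F : ℝ → ℝ≥0∞} (hF : Measurable F) :
    ∫⁻ y, F y * ENNReal.ofReal (Real.exp (c * y)) ∂expMeasure c =
      ENNReal.ofReal c * ∫⁻ y in Ioi 0, F y := by
  have hpdf : Measurable (exponentialPDF c) := (measurable_exponentialPDFReal c).ennreal_ofReal
  change ∫⁻ y, F y * ENNReal.ofReal (Real.exp (c * y)) ∂(volume.withDensity (exponentialPDF c)) = _
  rw [lintegral_withDensity_eq_lintegral_mul _ hpdf (by fun_prop), ← lintegral_const_mul _ hF,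
    setLIntegral_congr Ioi_ae_eq_Ici, ← lintegral_indicator measurableSet_Ici]
  refine lintegral_congr fun y => ?_
  rcases lt_or_ge y 0 with hy | hy
  · simp [exponentialPDF_of_neg hy, hy]
  · rw [Pi.mul_apply, exponentialPDF_of_nonneg hy, indicator_of_mem (mem_Ici.2 hy),
      ENNReal.ofReal_mul hc.le, Real.exp_neg]
    have h1 : ENNReal.ofReal (Real.exp (c * y))⁻¹ * ENNReal.ofReal (Real.exp (c * y)) = 1 := by
      rw [← ENNReal.ofReal_mul (by positivity), inv_mul_cancel₀ (Real.exp_pos _).ne',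
        ENNReal.ofReal_one]
    calc _ = ENNReal.ofReal c * F y *
        (ENNReal.ofReal (Real.exp (c * y))⁻¹ * ENNReal.ofReal (Real.exp (c * y))) := by ring
      _ = _ := by rw [h1, mul_one]

lemma expMeasure_Ioi {c : ℝ} (hc : 0 < c) {a : ℝ} (ha : 0 ≤ a) :
    expMeasure c (Ioi a) = ENNReal.ofReal (Real.exp (-(c * a))) := by
  have := isProbabilityMeasure_expMeasure hc
  rw [← compl_Iic, prob_compl_eq_one_sub measurableSet_Iic, ← ofReal_measureReal,
    ← cdf_eq_real, cdf_expMeasure_eq hc, if_pos ha, ← ENNReal.ofReal_one,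
    ← ENNReal.ofReal_sub _ (by simpa using by positivity)]
  simp

lemma ae_pos_expMeasure {c : ℝ} (hc : 0 < c) : ∀ᵐ y ∂expMeasure c, 0 < y := by
  have := isProbabilityMeasure_expMeasure hc
  exact (mem_ae_iff_prob_eq_one measurableSet_Ioi).2 (by simp [expMeasure_Ioi hc le_rfl])

section Marked

variable {α : Type*}

/-- The marked partial sums of a sequence of steps. -/
def markedSum {m : ℕ} (x : Fin m → ℝ × α) (i : Fin m) : ℝ × α :=
  (∑ j ∈ Finset.Iic i, (x j).1, (x i).2)

lemma markedSum_snoc_castSucc {m : ℕ} (x : Fin m → ℝ × α) (y : ℝ × α) (i : Fin m) :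
    markedSum (Fin.snoc x y : Fin (m + 1) → ℝ × α) i.castSucc = markedSum x i := by
  have : Finset.Iic i.castSucc = (Finset.Iic i).map Fin.castSuccEmb := by
    ext j
    simp only [Finset.mem_Iic, Finset.mem_map, Fin.coe_castSuccEmb]
    constructor
    · intro h
      exact ⟨j.castLT (lt_of_le_of_lt (Fin.le_def.1 h) i.2), by simpa [Fin.le_def] using h, rfl⟩
    · rintro ⟨k, hk, rfl⟩
      simpa using hk
  simp only [markedSum, this, Finset.sum_map, Fin.coe_castSuccEmb, Fin.snoc_castSucc (α := fun _ => ℝ × α)]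

lemma markedSum_last {m : ℕ} (x : Fin (m + 1) → ℝ × α) :
    markedSum x (Fin.last m) = (∑ j, (x j).1, (x (Fin.last m)).2) := by
  have : Finset.Iic (Fin.last m) = Finset.univ := by
    ext j
    simp [Fin.le_last]
  rw [markedSum, this]

lemma markedSum_snoc_last {m : ℕ} (x : Fin m → ℝ × α) (y : ℝ × α) :
    markedSum (Fin.snoc x y : Fin (m + 1) → ℝ × α) (Fin.last m) =
      (∑ j, (x j).1 + y.1, y.2) := by
  rw [markedSum_last, Fin.sum_univ_castSucc]
  simp only [Fin.snoc_castSucc (α := fun _ => ℝ × α), Fin.snoc_last (α := fun _ => ℝ × α)]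

variable [MeasurableSpace α]

lemma measurable_markedSum {m : ℕ} : Measurable (markedSum : (Fin m → ℝ × α) → _) := by
  unfold markedSum
  fun_prop

variable (P : Measure α)

/-- The law of one step of a marked exponential walk: a waiting time with rate `P univ`, together
with an independent mark distributed according to the normalization of `P`. -/
noncomputable def stepMeasure : Measure (ℝ × α) :=
  (expMeasure (P.real univ)).prod ((P univ)⁻¹ • P)

/-- The mean measure of a race with measure `P`. -/
noncomputable def raceMeasure : Measure (ℝ × α) := (volume.restrict (Ioi (0 : ℝ))).prod P

variable [IsFiniteMeasure P]

lemma measure_univ_eq_ofReal : P univ = ENNReal.ofReal (P.real univ) := by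
  rw [ofReal_measureReal]

variable [NeZero P]

lemma real_univ_pos : 0 < P.real univ := measureReal_univ_pos

instance isProbabilityMeasure_stepMeasure : IsProbabilityMeasure (stepMeasure P) := by
  have := isProbabilityMeasure_expMeasure (real_univ_pos P)
  unfold stepMeasure
  infer_instance

lemma ae_pos_stepMeasure : ∀ᵐ y ∂stepMeasure P, 0 < y.1 := by
  have := isProbabilityMeasure_expMeasure (real_univ_pos P)
  exact Measure.quasiMeasurePreserving_fst.ae (ae_pos_expMeasure (real_univ_pos P))

/-- Under the exponential weight, a step from `s` lands according to the mean measure of the race,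
up to the weight at `s`: the rate of the waiting time cancels the normalization of the mark. -/
lemma lintegral_stepMeasure {a s : ℝ} (ha : 0 ≤ a) (hs : s ≤ a) {D : Set (ℝ × α)}
    (hD : MeasurableSet D) (hDa : D ⊆ Ioi a ×ˢ univ) :
    ∫⁻ y, D.indicator 1 (s + y.1, y.2) * ENNReal.ofReal (Real.exp (P.real univ * (s + y.1)))
      ∂stepMeasure P = ENNReal.ofReal (Real.exp (P.real univ * s)) * raceMeasure P D := by
  have hc := real_univ_pos P
  have := isProbabilityMeasure_expMeasure hc
  have hind : Measurable (D.indicator (1 : ℝ × α → ℝ≥0∞)) := measurable_one.indicator hD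
  rw [stepMeasure, lintegral_prod_symm' _ (by fun_prop), raceMeasure, ← lintegral_indicator_one hD,
    lintegral_prod_symm' _ hind, lintegral_smul_measure, ← lintegral_const_mul _ (by fun_prop)]
  rw [smul_eq_mul, ← lintegral_const_mul _ (by fun_prop)]
  refine lintegral_congr fun x => ?_
  have h1 : ∀ t : ℝ, D.indicator (1 : ℝ × α → ℝ≥0∞) (s + t, x) *
      ENNReal.ofReal (Real.exp (P.real univ * (s + t))) =
      ENNReal.ofReal (Real.exp (P.real univ * s)) * (D.indicator (1 : ℝ × α → ℝ≥0∞) (s + t, x) *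
      ENNReal.ofReal (Real.exp (P.real univ * t))) := fun t => by
    rw [mul_add, Real.exp_add, ENNReal.ofReal_mul (Real.exp_pos _).le]
    ring
  simp_rw [h1]
  rw [lintegral_const_mul _ (by fun_prop),
    lintegral_mul_exp_expMeasure hc (F := fun t => D.indicator 1 (s + t, x)) (by fun_prop)]
  have h2 : ∀ b t : ℝ, b ≤ a → t ∉ Ioi (b : ℝ) → D.indicator (1 : ℝ × α → ℝ≥0∞) (t, x) = 0 :=
    fun b t hb ht => by
      refine indicator_of_notMem (fun h => ht ?_) _
      exact hb.trans_lt (hDa h).1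
  -- `D` lies after `a`, which is at least `s` and `0`, so neither restriction to `Ioi 0` removes
  -- anything and translation invariance applies.
  have h3 : ∫⁻ t in Ioi 0, D.indicator (1 : ℝ × α → ℝ≥0∞) (s + t, x) =
      ∫⁻ t in Ioi 0, D.indicator (1 : ℝ × α → ℝ≥0∞) (t, x) := by
    have h4 : (Ioi 0).indicator (fun t => D.indicator (1 : ℝ × α → ℝ≥0∞) (s + t, x)) =
        fun t => D.indicator (1 : ℝ × α → ℝ≥0∞) (s + t, x) := by
      refine indicator_eq_self.2 fun t ht => ?_
      by_contra h
      refine ht (h2 s (s + t) hs ?_)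
      simpa using h
    have h5 : (Ioi 0).indicator (fun t => D.indicator (1 : ℝ × α → ℝ≥0∞) (t, x)) =
        fun t => D.indicator (1 : ℝ × α → ℝ≥0∞) (t, x) := by
      refine indicator_eq_self.2 fun t ht => ?_
      by_contra h
      exact ht (h2 0 t ha h)
    rw [← lintegral_indicator measurableSet_Ioi, ← lintegral_indicator measurableSet_Ioi, h4, h5]
    exact lintegral_add_left_eq_self (fun t => D.indicator (1 : ℝ × α → ℝ≥0∞) (t, x)) s
  rw [h3, ← measure_univ_eq_ofReal]
  have h4 : (P univ)⁻¹ * P univ = 1 :=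
    ENNReal.inv_mul_cancel (NeZero.ne _) (measure_ne_top _ _)
  calc _ = (P univ)⁻¹ * P univ * (ENNReal.ofReal (Real.exp (P.real univ * s)) *
      ∫⁻ t in Ioi 0, D.indicator (1 : ℝ × α → ℝ≥0∞) (t, x)) := by ring
    _ = _ := by rw [h4, one_mul]

/-- Integrating out the last step by `lintegral_stepMeasure` yields the factor `raceMeasure P (D m)`
and leaves the weight of the shorter walk, so induction applies. -/
lemma lintegral_prod_indicator_markedSum {τ : ℕ → ℝ} (hτ : Monotone τ) (hτ0 : τ 0 = 0)
    {D : ℕ → Set (ℝ × α)} (hD : ∀ i, MeasurableSet (D i))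
    (hDτ : ∀ i, D i ⊆ Ioc (τ i) (τ (i + 1)) ×ˢ univ) (m : ℕ) :
    ∫⁻ x, (∏ i : Fin m, (D i).indicator 1 (markedSum x i)) *
      ENNReal.ofReal (Real.exp (P.real univ * ∑ j, (x j).1)) ∂Measure.pi (fun _ => stepMeasure P) =
      ∏ i : Fin m, raceMeasure P (D i) := by
  have hmeas : ∀ m (i : Fin m), Measurable fun x : Fin m → ℝ × α =>
      (D i).indicator (1 : ℝ × α → ℝ≥0∞) (markedSum x i) := fun m i =>
    (measurable_one.indicator (hD i)).comp ((measurable_pi_apply i).comp measurable_markedSum)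
  induction m with
  | zero => simp
  | succ m ih =>
    have hmp := (measurePreserving_piFinSuccAbove (fun _ : Fin (m + 1) => stepMeasure P)
      (Fin.last m)).symm
    have hsnoc : ∀ z : (ℝ × α) × (Fin m → ℝ × α),
        (MeasurableEquiv.piFinSuccAbove (fun _ : Fin (m + 1) => ℝ × α) (Fin.last m)).symm z =
          Fin.snoc z.2 z.1 := fun z => by
      simp [MeasurableEquiv.piFinSuccAbove]
      rfl
    have hms : Measurable fun x : Fin (m + 1) → ℝ × α =>
        (∏ i : Fin (m + 1), (D i).indicator (1 : ℝ × α → ℝ≥0∞) (markedSum x i)) *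
        ENNReal.ofReal (Real.exp (P.real univ * ∑ j, (x j).1)) :=
      (Finset.measurable_prod _ fun i _ => hmeas _ i).mul (by fun_prop)
    have hms' := hms.comp hmp.measurable
    simp only [Function.comp_def] at hms'
    rw [← hmp.lintegral_comp hms, lintegral_prod_symm' _ hms']
    simp_rw [hsnoc, Fin.prod_univ_castSucc, markedSum_snoc_castSucc, markedSum_snoc_last,
      Fin.sum_univ_castSucc, Fin.snoc_castSucc (α := fun _ => ℝ × α),
      Fin.snoc_last (α := fun _ => ℝ × α), Fin.val_castSucc, Fin.val_last]
    have hG : Measurable fun x : Fin m → ℝ × α =>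
        (∏ i : Fin m, (D i).indicator (1 : ℝ × α → ℝ≥0∞) (markedSum x i)) *
        ENNReal.ofReal (Real.exp (P.real univ * ∑ j, (x j).1)) :=
      (Finset.measurable_prod _ fun i _ => hmeas _ i).mul (by fun_prop)
    rw [← ih, ← lintegral_mul_const _ hG]
    refine lintegral_congr fun x => ?_
    simp_rw [mul_assoc]
    have hf : Measurable fun y : ℝ × α => (D m).indicator (1 : ℝ × α → ℝ≥0∞)
        (∑ j, (x j).1 + y.1, y.2) *
        ENNReal.ofReal (Real.exp (P.real univ * (∑ j, (x j).1 + y.1))) :=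
      ((measurable_one.indicator (hD m)).comp (by fun_prop)).mul (by fun_prop)
    rw [lintegral_const_mul _ hf]
    -- The one-step formula needs the current sum to be at most `τ m`, which holds when the last
    -- mark is in its strip; otherwise a factor of the product vanishes.
    by_cases hx : ∀ i : Fin m, markedSum x i ∈ D i
    · have hs : ∑ j, (x j).1 ≤ τ m := by
        cases m with
        | zero => simp [hτ0]
        | succ k =>
          have := (hDτ _ (hx (Fin.last k))).1.2
          rwa [markedSum_last] at this
      rw [lintegral_stepMeasure P (hτ0 ▸ hτ (Nat.zero_le m)) hs (hD m)
        ((hDτ m).trans (prod_mono Ioc_subset_Ioi_self subset_rfl))]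
    · push Not at hx
      obtain ⟨i, hi⟩ := hx
      rw [Finset.prod_eq_zero (Finset.mem_univ i) (indicator_of_notMem hi _), zero_mul, zero_mul]

/-- The probability that the marked partial sums lie in given subsets of consecutive time strips,
and the next partial sum is after a given time. -/
lemma measure_markedSum_mem {τ : ℕ → ℝ} (hτ : Monotone τ) (hτ0 : τ 0 = 0)
    {D : ℕ → Set (ℝ × α)} (hD : ∀ i, MeasurableSet (D i))
    (hDτ : ∀ i, D i ⊆ Ioc (τ i) (τ (i + 1)) ×ˢ univ) {m : ℕ} {u : ℝ} (hu : τ m ≤ u) :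
    ((Measure.pi fun _ : Fin m => stepMeasure P).prod (expMeasure (P.real univ)))
      {z | (∀ i : Fin m, markedSum z.1 i ∈ D i) ∧ u < ∑ j, (z.1 j).1 + z.2} =
      ENNReal.ofReal (Real.exp (-(P.real univ * u))) * ∏ i : Fin m, raceMeasure P (D i) := by
  have hc := real_univ_pos P
  have := isProbabilityMeasure_expMeasure hc
  have hms : MeasurableSet {z : (Fin m → ℝ × α) × ℝ |
      (∀ i : Fin m, markedSum z.1 i ∈ D i) ∧ u < ∑ j, (z.1 j).1 + z.2} := by
    have h : Measurable fun z : (Fin m → ℝ × α) × ℝ => ∑ j, (z.1 j).1 + z.2 := by fun_prop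
    refine MeasurableSet.inter ?_ (measurableSet_lt measurable_const h)
    have h' : {z : (Fin m → ℝ × α) × ℝ | ∀ i : Fin m, markedSum z.1 i ∈ D i} =
        ⋂ i : Fin m, (fun z => markedSum z.1 i) ⁻¹' D i := by
      ext
      simp
    change MeasurableSet {z : (Fin m → ℝ × α) × ℝ | ∀ i : Fin m, markedSum z.1 i ∈ D i}
    rw [h']
    exact MeasurableSet.iInter fun i =>
      ((measurable_pi_apply i).comp (measurable_markedSum.comp measurable_fst)) (hD i)
  have hmeas : ∀ i : Fin m, Measurable fun x : Fin m → ℝ × α =>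
      (D i).indicator (1 : ℝ × α → ℝ≥0∞) (markedSum x i) := fun i =>
    (measurable_one.indicator (hD i)).comp ((measurable_pi_apply i).comp measurable_markedSum)
  have hG : Measurable fun x : Fin m → ℝ × α =>
      (∏ i : Fin m, (D i).indicator (1 : ℝ × α → ℝ≥0∞) (markedSum x i)) *
      ENNReal.ofReal (Real.exp (P.real univ * ∑ j, (x j).1)) :=
    (Finset.measurable_prod _ fun i _ => hmeas i).mul (by fun_prop)
  -- Given the first `m` steps with sum `s ≤ u`, the next sum exceeds `u` with probability `exp (-c
  -- (u - s))`; its factor `exp (c s)` is the weight of `lintegral_prod_indicator_markedSum`.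
  rw [Measure.prod_apply hms, ← lintegral_prod_indicator_markedSum P hτ hτ0 hD hDτ,
    ← lintegral_const_mul _ hG]
  refine lintegral_congr fun x => ?_
  by_cases hx : ∀ i : Fin m, markedSum x i ∈ D i
  · have hs : ∑ j, (x j).1 ≤ u := by
      refine le_trans ?_ hu
      cases m with
      | zero => simp [hτ0]
      | succ k =>
        have := (hDτ _ (hx (Fin.last k))).1.2
        rwa [markedSum_last] at this
    have hset : Prod.mk x ⁻¹' {z : (Fin m → ℝ × α) × ℝ |
        (∀ i : Fin m, markedSum z.1 i ∈ D i) ∧ u < ∑ j, (z.1 j).1 + z.2} = Ioi (u - ∑ j, (x j).1) := by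
      ext y
      simp only [mem_preimage, mem_ofPred_eq, mem_Ioi, hx, implies_true, true_and]
      constructor <;> intro h <;> linarith
    rw [hset, expMeasure_Ioi hc (sub_nonneg.2 hs),
      Finset.prod_eq_one fun i _ => by simp [hx i], one_mul,
      ← ENNReal.ofReal_mul (Real.exp_pos _).le, ← Real.exp_add]
    congr 2
    ring
  · have hset : Prod.mk x ⁻¹' {z : (Fin m → ℝ × α) × ℝ |
        (∀ i : Fin m, markedSum z.1 i ∈ D i) ∧ u < ∑ j, (z.1 j).1 + z.2} = ∅ := by
      ext y
      simp [hx]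
    push Not at hx
    obtain ⟨i, hi⟩ := hx
    rw [hset, measure_empty, Finset.prod_eq_zero (Finset.mem_univ i) (indicator_of_notMem hi _),
      zero_mul, mul_zero]

end Marked

/-! ### Strips with rational end points determine the law. -/

section StripExt

variable {α : Type*} {m : ℕ}

/-- The times of the points `z.1`, followed by `z.2`, are positive and strictly increasing. -/
def HasIncreasingTimes (z : (Fin m → ℝ × α) × ℝ) : Prop :=
  ∃ t : ℕ → ℝ, StrictMono t ∧ 0 < t 0 ∧ (∀ i : Fin m, (z.1 i).1 = t i) ∧ z.2 = t m

/-- The partial sums of the absolute values of a finitely supported rational sequence. -/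
def ratTimes (σ : ℕ →₀ ℚ) (k : ℕ) : ℝ := ∑ j ∈ Finset.range k, |(σ j : ℝ)|

lemma ratTimes_zero (σ : ℕ →₀ ℚ) : ratTimes σ 0 = 0 := rfl

lemma monotone_ratTimes (σ : ℕ →₀ ℚ) : Monotone (ratTimes σ) :=
  monotone_nat_of_le_succ fun k => by
    rw [ratTimes, ratTimes, Finset.sum_range_succ]
    exact le_add_of_nonneg_right (abs_nonneg _)

/-- The sequences of points in consecutive time strips with given rational end points, followed by
a later time. -/
def ratStrips (m : ℕ) (σ : ℕ →₀ ℚ) : Set ((Fin m → ℝ × α) × ℝ) :=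
  {z | (∀ i : Fin m, z.1 i ∈ Ioc (ratTimes σ i) (ratTimes σ (i + 1)) ×ˢ univ) ∧ ratTimes σ m < z.2}

lemma HasIncreasingTimes.exists_mem_ratStrips {z : (Fin m → ℝ × α) × ℝ} (hz : HasIncreasingTimes z) :
    ∃ σ : ℕ →₀ ℚ, z ∈ ratStrips m σ := by
  obtain ⟨t, ht, ht0, hti, htm⟩ := hz
  choose q hq hq' using fun k => exists_rat_btwn (ht (Nat.lt_succ_self k))
  -- The shift by one makes `τ k < t k ≤ τ (k + 1)`, so time `t k` falls in strip `k`.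
  let τ : ℕ → ℚ := fun k => match k with
    | 0 => 0
    | k + 1 => q k
  have hτ : ∀ k, (τ k : ℝ) < t k := fun k => by
    cases k with
    | zero => simpa [τ] using ht0
    | succ k => exact hq' k
  have hmono : ∀ k, 0 ≤ (τ (k + 1) : ℝ) - τ k := fun k =>
    sub_nonneg.2 ((hτ k).le.trans (hq k).le)
  -- Only the first `m` increments matter; finite support keeps the index set of the strip systems
  -- countable.
  let σ : ℕ →₀ ℚ := Finsupp.onFinset (Finset.range m)
    (fun k => if k < m then τ (k + 1) - τ k else 0) (fun k hk => by
      by_contra h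
      rw [Finset.mem_range] at h
      simp [h] at hk)
  have hσ : ∀ k ≤ m, ratTimes σ k = τ k := fun k hk => by
    have : ratTimes σ k = ∑ j ∈ Finset.range k, ((τ (j + 1) : ℝ) - τ j) := by
      refine Finset.sum_congr rfl fun j hj => ?_
      have hj' : j < m := (Finset.mem_range.1 hj).trans_le hk
      simp only [σ, Finsupp.onFinset_apply, if_pos hj', Rat.cast_sub]
      exact abs_of_nonneg (hmono j)
    rw [this, Finset.sum_range_sub (fun j => (τ j : ℝ))]
    simp [τ]
  refine ⟨σ, fun i => ⟨?_, trivial⟩, ?_⟩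
  · rw [hσ i i.2.le, hσ (i + 1) i.2, hti]
    exact ⟨hτ i, (hq i).le⟩
  · rw [hσ m le_rfl, htm]
    exact hτ m

variable [MeasurableSpace α]

lemma measurableSet_pi_prod_Ioi {D : Fin m → Set (ℝ × α)} (hD : ∀ i, MeasurableSet (D i)) (u : ℝ) :
    MeasurableSet {z : (Fin m → ℝ × α) × ℝ | (∀ i, z.1 i ∈ D i) ∧ u < z.2} := by
  have : {z : (Fin m → ℝ × α) × ℝ | (∀ i, z.1 i ∈ D i) ∧ u < z.2} = univ.pi D ×ˢ Ioi u := by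
    ext z
    simp
  rw [this]
  exact (MeasurableSet.univ_pi hD).prod measurableSet_Ioi

lemma measurableSet_exists_mem_ratStrips :
    MeasurableSet {z : (Fin m → ℝ × α) × ℝ | ∃ σ : ℕ →₀ ℚ, z ∈ ratStrips m σ} := by
  have : {z : (Fin m → ℝ × α) × ℝ | ∃ σ : ℕ →₀ ℚ, z ∈ ratStrips m σ} = ⋃ σ, ratStrips m σ := by
    ext
    simp
  rw [this]
  exact MeasurableSet.iUnion fun σ =>
    measurableSet_pi_prod_Ioi (fun i => measurableSet_Ioc.prod MeasurableSet.univ) _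

lemma ae_map_exists_mem_ratStrips {β : Type*} [MeasurableSpace β] {ρ : Measure β}
    {f : β → (Fin m → ℝ × α) × ℝ} (hf : AEMeasurable f ρ) (h : ∀ᵐ x ∂ρ, HasIncreasingTimes (f x)) :
    ∀ᵐ z ∂ρ.map f, ∃ σ, z ∈ ratStrips m σ :=
  (ae_map_iff hf measurableSet_exists_mem_ratStrips).2 (h.mono fun _ => (·.exists_mem_ratStrips))

/-- Two laws of points with increasing times are equal if they agree on products of subsets of
consecutive time strips. -/
lemma ext_of_strips {Q Q' : Measure ((Fin m → ℝ × α) × ℝ)} [IsFiniteMeasure Q]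
    (hQ : ∀ᵐ z ∂Q, ∃ σ, z ∈ ratStrips m σ) (hQ' : ∀ᵐ z ∂Q', ∃ σ, z ∈ ratStrips m σ)
    (h : ∀ (τ : ℕ → ℝ) (D : ℕ → Set (ℝ × α)) (u : ℝ), Monotone τ → τ 0 = 0 →
      (∀ i, MeasurableSet (D i)) → (∀ i, D i ⊆ Ioc (τ i) (τ (i + 1)) ×ˢ univ) → τ m ≤ u →
      Q {z | (∀ i : Fin m, z.1 i ∈ D i) ∧ u < z.2} =
        Q' {z | (∀ i : Fin m, z.1 i ∈ D i) ∧ u < z.2}) : Q = Q' := by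
  have hstrip : ∀ (σ : ℕ →₀ ℚ) (F : Fin m → Set (ℝ × α)) (u : ℝ), (∀ i, MeasurableSet (F i)) →
      Q (univ.pi F ×ˢ Ioi u ∩ ratStrips m σ) = Q' (univ.pi F ×ˢ Ioi u ∩ ratStrips m σ) := by
    intro σ F u hF
    let G : ℕ → Set (ℝ × α) := fun k => (if hk : k < m then F ⟨k, hk⟩ else ∅) ∩
      Ioc (ratTimes σ k) (ratTimes σ (k + 1)) ×ˢ univ
    -- Cutting a rectangle by a strip system gives an event covered by `h`, with the final time
    -- raised to at least `ratTimes σ m`.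
    have hs : univ.pi F ×ˢ Ioi u ∩ ratStrips m σ =
        {z | (∀ i : Fin m, z.1 i ∈ G i) ∧ max u (ratTimes σ m) < z.2} := by
      ext z
      simp only [ratStrips, G, mem_inter_iff, mem_prod, mem_univ_pi, mem_Ioi, mem_ofPred_eq, max_lt_iff,
        Fin.is_lt, dif_pos, Fin.eta, forall_and]
      tauto
    rw [hs]
    refine h (ratTimes σ) G _ (monotone_ratTimes σ) (ratTimes_zero σ) (fun k => ?_)
      (fun k => inter_subset_right) (le_max_right _ _)
    refine MeasurableSet.inter ?_ (measurableSet_Ioc.prod MeasurableSet.univ)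
    split_ifs with hk
    · exact hF _
    · exact MeasurableSet.empty
  have hB : ∀ σ, Q (ratStrips m σ) = Q' (ratStrips m σ) := fun σ =>
    h (ratTimes σ) (fun k => Ioc (ratTimes σ k) (ratTimes σ (k + 1)) ×ˢ univ) (ratTimes σ m)
      (monotone_ratTimes σ) (ratTimes_zero σ)
      (fun k => measurableSet_Ioc.prod MeasurableSet.univ) (fun k => subset_rfl) le_rfl
  have hN : Q (⋃ σ, ratStrips m σ)ᶜ = 0 :=
    measure_mono_null (fun z hz hz' => hz (mem_iUnion.2 hz')) hQ
  have hN' : Q' (⋃ σ, ratStrips m σ)ᶜ = 0 :=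
    measure_mono_null (fun z hz hz' => hz (mem_iUnion.2 hz')) hQ'
  let C : Set (Set (Fin m → ℝ × α)) := univ.pi '' univ.pi fun _ => {s | MeasurableSet s}
  have hspan : IsCountablySpanning C :=
    IsCountablySpanning.pi fun _ => isCountablySpanning_measurableSet
  have hspan' : IsCountablySpanning (range (Ioi : ℝ → Set ℝ)) := by
    refine ⟨fun n : ℕ => Ioi (-n : ℝ), fun n => mem_range_self _, eq_univ_of_forall fun x => ?_⟩
    obtain ⟨n, hn⟩ := exists_nat_gt (-x)
    exact mem_iUnion.2 ⟨n, by simpa using by linarith⟩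
  -- Rectangles form a generating π-system; the cover consists of the countably many strip systems
  -- and the complement of their union, which is null for both measures.
  refine Measure.ext_of_generateFrom_of_cover
    (S := image2 (· ×ˢ ·) C (range Ioi)) (T := insert (⋃ σ, ratStrips m σ)ᶜ (range (ratStrips m)))
    (generateFrom_eq_prod generateFrom_pi (borel_eq_generateFrom_Ioi ℝ ▸
      (BorelSpace.measurable_eq (α := ℝ)).symm) hspan hspan').symm
    ((countable_range (ratStrips m)).insert _) (isPiSystem_pi.prod (isPiSystem_Ioi)) ?_
    (fun t _ => measure_ne_top Q t) ?_ ?_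
  · rw [sUnion_insert, sUnion_range, compl_union_self]
  · rintro t (rfl | ⟨σ, rfl⟩) _ ⟨_, ⟨F, hF, rfl⟩, _, ⟨u, rfl⟩, rfl⟩
    · rw [measure_mono_null inter_subset_right hN, measure_mono_null inter_subset_right hN']
    · exact hstrip σ F u fun i => hF i trivial
  · rintro t (rfl | ⟨σ, rfl⟩)
    · rw [hN, hN']
    · exact hB σ

end StripExt

/-! ### Counts of a Poisson process. -/

lemma extPoisson_singleton {r : ℝ≥0∞} (hr : r ≠ ∞) (k : ℕ) :
    extPoisson r {(k : ℕ∞)} =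
      ENNReal.ofReal (Real.exp (-r.toReal) * r.toReal ^ k / (k.factorial : ℝ)) := by
  rw [extPoisson, if_neg hr, Measure.map_apply (by fun_prop) (measurableSet_singleton _)]
  have : (fun k : ℕ => (k : ℕ∞)) ⁻¹' {(k : ℕ∞)} = {k} := by
    ext
    simp
  rw [this, poissonMeasure_singleton, ENNReal.coe_toNNReal_eq_toReal]

lemma extPoisson_zero {r : ℝ≥0∞} (hr : r ≠ ∞) :
    extPoisson r {0} = ENNReal.ofReal (Real.exp (-r.toReal)) := by
  simpa using extPoisson_singleton hr 0

lemma extPoisson_one {r : ℝ≥0∞} (hr : r ≠ ∞) :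
    extPoisson r {1} = ENNReal.ofReal (Real.exp (-r.toReal)) * r := by
  have := extPoisson_singleton hr 1
  rw [Nat.cast_one] at this
  rw [this, pow_one, Nat.factorial_one, Nat.cast_one, div_one,
    ENNReal.ofReal_mul (Real.exp_pos _).le, ENNReal.ofReal_toReal hr]

lemma extPoisson_top {r : ℝ≥0∞} (hr : r ≠ ∞) : extPoisson r {⊤} = 0 := by
  rw [extPoisson, if_neg hr, Measure.map_apply (by fun_prop) (measurableSet_singleton _)]
  have : (fun k : ℕ => (k : ℕ∞)) ⁻¹' {⊤} = ∅ := by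
    ext
    simp
  rw [this, measure_empty]

namespace IsPoissonProcess

variable {Ω S : Type*} [MeasurableSpace Ω] [MeasurableSpace S] {R : Ω → Set S} {ν : Measure S}
  [SigmaFinite ν] [NullSingletonClass ν] {μ : Measure Ω}

lemma measure_encard_eq (hR : IsPoissonProcess R ν μ) {B : Set S} (hB : MeasurableSet B) (k : ℕ∞) :
    μ ((fun ω => (R ω ∩ B).encard) ⁻¹' {k}) = extPoisson (ν B) {k} := by
  rw [← (hR.hasLaw_count B hB).map_eq,
    Measure.map_apply_of_aemeasurable (hR.hasLaw_count B hB).aemeasurable (measurableSet_singleton _)]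

lemma nullMeasurableSet_encard_eq (hR : IsPoissonProcess R ν μ) {B : Set S}
    (hB : MeasurableSet B) (k : ℕ∞) : NullMeasurableSet {ω | (R ω ∩ B).encard = k} μ :=
  (hR.hasLaw_count B hB).aemeasurable.nullMeasurable (measurableSet_singleton k)

lemma ae_finite (hR : IsPoissonProcess R ν μ) {B : Set S} (hB : MeasurableSet B) (h : ν B ≠ ∞) :
    ∀ᵐ ω ∂μ, (R ω ∩ B).Finite := by
  have := hR.measure_encard_eq hB ⊤
  rw [extPoisson_top h] at this
  filter_upwards [measure_eq_zero_iff_ae_notMem.1 this] with ω hω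
  exact encard_ne_top_iff.1 hω

lemma ae_infinite (hR : IsPoissonProcess R ν μ) {B : Set S} (hB : MeasurableSet B) (h : ν B = ∞) :
    ∀ᵐ ω ∂μ, (R ω ∩ B).Infinite := by
  have h1 := hR.hasLaw_count B hB
  rw [h, extPoisson, if_pos rfl] at h1
  have h2 : ∀ᵐ k ∂(μ.map fun ω => (R ω ∩ B).encard), k = ⊤ := by
    rw [h1.map_eq]
    exact (ae_dirac_iff (measurableSet_singleton _)).2 rfl
  filter_upwards [ae_of_ae_map h1.aemeasurable h2] with ω hω
  exact encard_eq_top_iff.1 hω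

/-- Independence transported to any finite index type, so that strips and their pieces can be
indexed directly. -/
lemma measure_iInter_encard_eq (hR : IsPoissonProcess R ν μ) {ι : Type*} [Fintype ι]
    {A : ι → Set S} (hA : ∀ i, MeasurableSet (A i)) (hdisj : Pairwise fun i j => Disjoint (A i) (A j))
    (k : ι → ℕ∞) : μ {ω | ∀ i, (R ω ∩ A i).encard = k i} = ∏ i, extPoisson (ν (A i)) {k i} := by
  let e := Fintype.equivFin ι
  have h := (hR.iIndepFun_count (Fintype.card ι) (A ∘ e.symm) (fun j => hA _)
    (fun i j hij => hdisj (e.symm.injective.ne hij))).precomp e.injective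
  have h' := h.measure_inter_preimage_eq_mul Finset.univ
    (sets := fun i => {k i}) (fun i _ => measurableSet_singleton _)
  simp only [Function.comp_apply, Equiv.symm_apply_apply] at h'
  simp_rw [← fun i => hR.measure_encard_eq (hA i) (k i), ← h']
  congr 1
  ext ω
  simp

end IsPoissonProcess

section RaceMeasure

variable {α : Type*} [MeasurableSpace α] (P : Measure α) [IsFiniteMeasure P]

lemma raceMeasure_prod_univ (s : Set ℝ) (hs : MeasurableSet s) :
    raceMeasure P (s ×ˢ univ) = volume (s ∩ Ioi 0) * P univ := by
  rw [raceMeasure, Measure.prod_prod, Measure.restrict_apply hs]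

lemma raceMeasure_Ioc {a : ℝ} (ha : 0 ≤ a) (b : ℝ) :
    raceMeasure P (Ioc a b ×ˢ univ) = ENNReal.ofReal (b - a) * P univ := by
  rw [raceMeasure_prod_univ P _ measurableSet_Ioc,
    inter_eq_left.2 (show Ioc a b ⊆ Ioi 0 from fun x hx => ha.trans_lt hx.1), Real.volume_Ioc]

lemma raceMeasure_Iic_ne_top (a : ℝ) : raceMeasure P (Iic a ×ˢ univ) ≠ ∞ := by
  rw [raceMeasure_prod_univ P _ measurableSet_Iic, Iic_inter_Ioi, Real.volume_Ioc]
  exact ENNReal.mul_ne_top ENNReal.ofReal_ne_top (measure_ne_top _ _)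

lemma raceMeasure_univ [NeZero P] : raceMeasure P univ = ∞ := by
  rw [← univ_prod_univ, raceMeasure_prod_univ P _ MeasurableSet.univ, univ_inter, Real.volume_Ioi]
  exact ENNReal.top_mul (NeZero.ne _)

end RaceMeasure

/-! ### Arrivals of an exponential race. -/

namespace IsExponentialRace

variable {Ω : Type*} [MeasurableSpace Ω] {n : ℕ} {R : Ω → Set (ℝ × EuclideanSpace ℝ (Fin n))}
  {P : Measure (EuclideanSpace ℝ (Fin n))} [IsFiniteMeasure P] {μ : Measure Ω}

lemma ae_isRaceSet [NeZero P] (hR : IsExponentialRace R P μ) : ∀ᵐ ω ∂μ, IsRaceSet (R ω) := by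
  have hfin : ∀ᵐ ω ∂μ, ∀ K : ℕ, (R ω ∩ Iic (K : ℝ) ×ˢ univ).Finite :=
    ae_all_iff.2 fun K => hR.isPoissonProcess.ae_finite
      (measurableSet_Iic.prod MeasurableSet.univ) (raceMeasure_Iic_ne_top P K)
  filter_upwards [hR.subset, hR.totallyOrdered, hfin,
    hR.isPoissonProcess.ae_infinite MeasurableSet.univ (raceMeasure_univ P)] with ω h1 h2 h3 h4
  refine ⟨fun p hp => (h1 hp).1, h2, fun t => ?_, by simpa using h4⟩
  obtain ⟨K, hK⟩ := exists_nat_ge t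
  exact (h3 K).subset fun p hp => ⟨hp.1, hp.2.trans hK, trivial⟩

/-- Only counts are known to be measurable; `arrival_mem_iff` writes the event as a countable union
of count events. -/
lemma aemeasurable_arrival [NeZero P] (hR : IsExponentialRace R P μ) (i : ℕ) :
    AEMeasurable (fun ω => arrival (R ω) i) μ := by
  refine NullMeasurable.aemeasurable fun D hD => ?_
  have hN := fun {B} hB k => hR.isPoissonProcess.nullMeasurableSet_encard_eq (B := B) hB k
  have : NullMeasurableSet (⋃ q : ℚ, ⋃ q' : ℚ,
      {ω | (R ω ∩ Iic (q : ℝ) ×ˢ univ).encard = i} ∩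
      ({ω | (R ω ∩ Iic (q' : ℝ) ×ˢ univ).encard = (i + 1 : ℕ)} ∩
      {ω | (R ω ∩ (Ioc (q : ℝ) q' ×ˢ univ ∩ D)).encard = 1})) μ :=
    NullMeasurableSet.iUnion fun q => NullMeasurableSet.iUnion fun q' =>
      (hN (measurableSet_Iic.prod MeasurableSet.univ) _).inter
        ((hN (measurableSet_Iic.prod MeasurableSet.univ) _).inter
          (hN ((measurableSet_Ioc.prod MeasurableSet.univ).inter hD) _))
  refine this.congr ?_
  filter_upwards [hR.ae_isRaceSet] with ω hω
  refine propext (Iff.trans ?_ (hω.arrival_mem_iff i D).symm)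
  exact mem_iUnion.trans (exists_congr fun q => mem_iUnion)

/-- The probability that the first arrivals lie in given subsets of consecutive time strips,
and the next arrival is after a given time. -/
lemma measure_arrival_mem [NeZero P] (hR : IsExponentialRace R P μ) {τ : ℕ → ℝ} (hτ : Monotone τ)
    (hτ0 : τ 0 = 0) {D : ℕ → Set (ℝ × EuclideanSpace ℝ (Fin n))} (hD : ∀ i, MeasurableSet (D i))
    (hDτ : ∀ i, D i ⊆ Ioc (τ i) (τ (i + 1)) ×ˢ univ) {m : ℕ} {u : ℝ} (hu : τ m ≤ u) :
    μ {ω | (∀ i : Fin m, arrival (R ω) i ∈ D i) ∧ u < (arrival (R ω) m).1} =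
      ENNReal.ofReal (Real.exp (-(P.real univ * u))) * ∏ i : Fin m, raceMeasure P (D i) := by
  have hpos : ∀ k, 0 ≤ τ k := fun k => hτ0 ▸ hτ (Nat.zero_le k)
  -- Disjoint pieces: `true` is the target set in a strip, `false` the rest of that strip, `none`
  -- the final gap.
  let A : Option (Fin m × Bool) → Set (ℝ × EuclideanSpace ℝ (Fin n)) := fun o => match o with
    | none => Ioc (τ m) u ×ˢ univ
    | some (i, true) => D i
    | some (i, false) => Ioc (τ i) (τ (i + 1)) ×ˢ univ \ D i
  let k : Option (Fin m × Bool) → ℕ∞ := fun o => match o with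
    | none => 0
    | some (_, true) => 1
    | some (_, false) => 0
  have hA : ∀ o, MeasurableSet (A o) := by
    rintro (_ | ⟨i, _ | _⟩)
    · exact measurableSet_Ioc.prod MeasurableSet.univ
    · exact (measurableSet_Ioc.prod MeasurableSet.univ).diff (hD i)
    · exact hD i
  have hsub : ∀ i b, A (some (i, b)) ⊆ Ioc (τ i) (τ (i + 1)) ×ˢ univ := by
    rintro i (_ | _)
    · exact sdiff_subset
    · exact hDτ i
  have hlt : ∀ i j : Fin m, i < j → ∀ b b', Disjoint (A (some (i, b))) (A (some (j, b'))) := by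
    refine fun i j hij b b' => disjoint_left.2 fun p hp hp' => ?_
    have h1 := (hsub i b hp).1.2
    have h2 := (hsub j b' hp').1.1
    exact absurd (h1.trans (hτ (Nat.succ_le_of_lt hij))) h2.not_ge
  have hnone : ∀ i b, Disjoint (A (some (i, b))) (A none) := by
    refine fun i b => disjoint_left.2 fun p hp hp' => ?_
    have h1 := (hsub i b hp).1.2
    exact absurd (h1.trans (hτ (Nat.succ_le_of_lt i.2))) hp'.1.1.not_ge
  have hdisj : Pairwise fun o o' => Disjoint (A o) (A o') := by
    rintro (_ | ⟨i, b⟩) (_ | ⟨j, b'⟩) hne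
    · exact absurd rfl hne
    · exact (hnone j b').symm
    · exact hnone i b
    · rcases lt_trichotomy i j with hij | rfl | hij
      · exact hlt i j hij b b'
      · cases b <;> cases b'
        · exact absurd rfl hne
        · exact disjoint_sdiff_left
        · exact disjoint_sdiff_right
        · exact absurd rfl hne
      · exact (hlt j i hij b' b).symm
  have hevent : μ {ω | (∀ i : Fin m, arrival (R ω) i ∈ D i) ∧ u < (arrival (R ω) m).1} =
      μ {ω | ∀ o, (R ω ∩ A o).encard = k o} := by
    refine measure_congr ?_
    filter_upwards [hR.ae_isRaceSet] with ω hω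
    refine propext ⟨fun h o => ?_, fun h => ?_⟩
    · have h' := hω.encard_of_arrival_mem hτ hu hDτ (fun i hi => h.1 ⟨i, hi⟩) h.2
      rcases o with _ | ⟨i, _ | _⟩
      · exact h'.2
      · exact (h'.1 i i.2).2
      · exact (h'.1 i i.2).1
    · have h' := hω.arrival_mem_of_encard hτ hτ0 hDτ
        (fun i hi => ⟨h (some (⟨i, hi⟩, true)), h (some (⟨i, hi⟩, false))⟩) (h none)
      exact ⟨fun i => h'.1 i i.2, h'.2⟩
  have hexp : ∀ a b : ℝ, 0 ≤ a → a ≤ b → (raceMeasure P (Ioc a b ×ˢ univ)).toReal =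
      P.real univ * (b - a) := fun a b ha hab => by
    rw [raceMeasure_Ioc P ha, ENNReal.toReal_mul, ENNReal.toReal_ofReal (sub_nonneg.2 hab), mul_comm]
    rfl
  have hfin : ∀ a b : ℝ, 0 ≤ a → raceMeasure P (Ioc a b ×ˢ univ) ≠ ∞ := fun a b ha => by
    rw [raceMeasure_Ioc P ha]
    exact ENNReal.mul_ne_top ENNReal.ofReal_ne_top (measure_ne_top _ _)
  -- One point in `D i` and none elsewhere in its strip: the two exponentials combine into that of
  -- the whole strip.
  have hfac : ∀ i : Fin m, extPoisson (raceMeasure P (A (some (i, true)))) {k (some (i, true))} *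
      extPoisson (raceMeasure P (A (some (i, false)))) {k (some (i, false))} =
      ENNReal.ofReal (Real.exp (-(P.real univ * (τ (i + 1) - τ i)))) * raceMeasure P (D i) := by
    intro i
    have hf := hfin (τ i) (τ (i + 1)) (hpos i)
    have h1 : raceMeasure P (D i) ≠ ∞ := measure_ne_top_of_subset (hDτ i) hf
    have h2 : raceMeasure P (Ioc (τ i) (τ (i + 1)) ×ˢ univ \ D i) ≠ ∞ :=
      measure_ne_top_of_subset sdiff_subset hf
    have h3 : (raceMeasure P (D i)).toReal +
        (raceMeasure P (Ioc (τ i) (τ (i + 1)) ×ˢ univ \ D i)).toReal =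
        P.real univ * (τ (i + 1) - τ i) := by
      rw [← hexp _ _ (hpos i) (hτ (Nat.le_succ i)), ← ENNReal.toReal_add h1 h2,
        ← measure_inter_add_sdiff (Ioc (τ i) (τ (i + 1)) ×ˢ univ) (hD i),
        inter_eq_right.2 (hDτ i)]
    change extPoisson (raceMeasure P (D i)) {1} *
      extPoisson (raceMeasure P (Ioc (τ i) (τ (i + 1)) ×ˢ univ \ D i)) {0} = _
    rw [extPoisson_one h1, extPoisson_zero h2, ← h3, neg_add, Real.exp_add,
      ENNReal.ofReal_mul (Real.exp_pos _).le]
    ring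
  have htel : ∀ m : ℕ, ∏ i : Fin m,
      ENNReal.ofReal (Real.exp (-(P.real univ * (τ (i + 1) - τ i)))) =
      ENNReal.ofReal (Real.exp (-(P.real univ * τ m))) := by
    intro m
    induction m with
    | zero => simp [hτ0]
    | succ m ih =>
      rw [Fin.prod_univ_castSucc]
      simp only [Fin.val_castSucc, Fin.val_last]
      rw [ih, ← ENNReal.ofReal_mul (Real.exp_pos _).le, ← Real.exp_add]
      congr 2
      ring
  have hk : extPoisson (raceMeasure P (A none)) {k none} =
      ENNReal.ofReal (Real.exp (-(P.real univ * (u - τ m)))) := by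
    rw [← hexp _ _ (hpos m) hu]
    exact extPoisson_zero (hfin _ _ (hpos m))
  have hprod := hR.isPoissonProcess.measure_iInter_encard_eq hA hdisj k
  rw [hevent, hprod]
  change ∏ o, extPoisson (raceMeasure P (A o)) {k o} = _
  rw [Fintype.prod_option, Fintype.prod_prod_type]
  simp_rw [Fintype.prod_bool, hfac, Finset.prod_mul_distrib, htel]
  rw [hk, ← mul_assoc, ← ENNReal.ofReal_mul (Real.exp_pos _).le, ← Real.exp_add]
  congr 3
  ring

end IsExponentialRace

/-! ### Comparison of the two joint laws. -/

lemma sum_Iic_eq_sum_range {M : Type*} [AddCommMonoid M] {m : ℕ} (f : Fin m → M) (g : ℕ → M)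
    (h : ∀ i : Fin m, f i = g i) (i : Fin m) :
    ∑ j ∈ Finset.Iic i, f j = ∑ j ∈ Finset.range (i + 1), g j := by
  refine Finset.sum_bij (fun j _ => (j : ℕ)) (fun j hj => ?_) (fun _ _ _ _ => Fin.ext)
    (fun j hj => ?_) (fun j _ => h j)
  · rw [Finset.mem_range, Nat.lt_succ_iff]
    exact Fin.le_def.1 (Finset.mem_Iic.1 hj)
  · rw [Finset.mem_range, Nat.lt_succ_iff] at hj
    exact ⟨⟨j, hj.trans_lt i.2⟩, Finset.mem_Iic.2 hj, rfl⟩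

lemma hasIncreasingTimes_markedSum {α : Type*} {m : ℕ} {x : Fin m → ℝ × α} {y : ℝ}
    (hx : ∀ i, 0 < (x i).1) (hy : 0 < y) :
    HasIncreasingTimes (markedSum x, ∑ j, (x j).1 + y) := by
  -- Repeating `y` from index `m` on keeps all steps positive, so the times increase along all of
  -- `ℕ`.
  let l : ℕ → ℝ := fun k => if hk : k < m then (x ⟨k, hk⟩).1 else y
  have hl : ∀ k, 0 < l k := fun k => by
    dsimp only [l]
    split_ifs with hk
    · exact hx _
    · exact hy
  have hxl : ∀ i : Fin m, (x i).1 = l i := fun i => by simp [l]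
  refine ⟨fun k => ∑ j ∈ Finset.range (k + 1), l j, strictMono_nat_of_lt_succ fun k => ?_, ?_,
    sum_Iic_eq_sum_range (fun i => (x i).1) l hxl, ?_⟩
  · rw [Finset.sum_range_succ _ (k + 1)]
    exact lt_add_of_pos_right _ (hl _)
  · simpa using hl 0
  · change ∑ j, (x j).1 + y = ∑ j ∈ Finset.range (m + 1), l j
    rw [Finset.sum_range_succ, ← Fin.sum_univ_eq_sum_range,
      Finset.sum_congr rfl fun i _ => hxl i]
    simp [l]

/-- The law of the first arrivals of an exponential race. -/
lemma IsExponentialRace.map_arrival {Ω : Type*} [MeasurableSpace Ω] {n : ℕ}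
    {R : Ω → Set (ℝ × EuclideanSpace ℝ (Fin n))} {P : Measure (EuclideanSpace ℝ (Fin n))}
    [IsFiniteMeasure P] [NeZero P] {μ : Measure Ω} [IsProbabilityMeasure μ]
    (hR : IsExponentialRace R P μ) (m : ℕ) :
    μ.map (fun ω (i : Fin m) => arrival (R ω) i) =
      (Measure.pi fun _ : Fin m => stepMeasure P).map markedSum := by
  have hc := real_univ_pos P
  have := isProbabilityMeasure_expMeasure hc
  let ρ := (Measure.pi fun _ : Fin m => stepMeasure P).prod (expMeasure (P.real univ))
  let f : Ω → (Fin m → ℝ × EuclideanSpace ℝ (Fin n)) × ℝ :=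
    fun ω => (fun i => arrival (R ω) i, (arrival (R ω) m).1)
  let g : (Fin m → ℝ × EuclideanSpace ℝ (Fin n)) × ℝ →
    (Fin m → ℝ × EuclideanSpace ℝ (Fin n)) × ℝ := fun z => (markedSum z.1, ∑ j, (z.1 j).1 + z.2)
  have hf1 : AEMeasurable (fun ω (i : Fin m) => arrival (R ω) i) μ :=
    aemeasurable_pi_lambda _ fun i => hR.aemeasurable_arrival i
  have hf : AEMeasurable f μ := hf1.prodMk (measurable_fst.comp_aemeasurable
    (hR.aemeasurable_arrival m))
  have hg : Measurable g := (measurable_markedSum.comp measurable_fst).prodMk (by fun_prop)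
  have key : μ.map f = ρ.map g := by
    refine ext_of_strips (ae_map_exists_mem_ratStrips hf ?_)
      (ae_map_exists_mem_ratStrips hg.aemeasurable ?_) ?_
    · filter_upwards [hR.ae_isRaceSet] with ω hω
      exact ⟨fun k => (arrival (R ω) k).1, hω.strictMono_arrival, hω.pos _ (hω.arrival_mem 0),
        fun i => rfl, rfl⟩
    · have h1 : ∀ᵐ x ∂(Measure.pi fun _ : Fin m => stepMeasure P), ∀ i, 0 < (x i).1 :=
        ae_all_iff.2 fun i =>
          (Measure.quasiMeasurePreserving_eval (fun _ : Fin m => stepMeasure P) i).ae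
            (ae_pos_stepMeasure P)
      filter_upwards [Measure.quasiMeasurePreserving_fst.ae h1,
        Measure.quasiMeasurePreserving_snd.ae (ae_pos_expMeasure hc)] with z hz1 hz2
      exact hasIncreasingTimes_markedSum hz1 hz2
    · intro τ D u hτ hτ0 hD hDτ hu
      have hm := measurableSet_pi_prod_Ioi (m := m) (D := fun i => D i) (fun i => hD i) u
      rw [Measure.map_apply_of_aemeasurable hf hm, Measure.map_apply hg hm]
      exact (hR.measure_arrival_mem hτ hτ0 hD hDτ hu).trans
        (measure_markedSum_mem P hτ hτ0 hD hDτ hu).symm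
  calc μ.map (fun ω (i : Fin m) => arrival (R ω) i)
      = (μ.map f).map Prod.fst :=
        (AEMeasurable.map_map_of_aemeasurable measurable_fst.aemeasurable hf).symm
    _ = (ρ.map Prod.fst).map markedSum := by
        rw [key, Measure.map_map measurable_fst hg, Measure.map_map measurable_markedSum
          measurable_fst]
        rfl
    _ = _ := by rw [Measure.map_fst_prod, measure_univ, one_smul]

/-- The law of a sequence of steps, composed of independent waiting times and marks. -/
lemma map_steps_eq_pi {α Ω : Type*} [MeasurableSpace α] [MeasurableSpace Ω]
    {P : Measure α} [IsFiniteMeasure P] [NeZero P] {μ : Measure Ω} [IsProbabilityMeasure μ] {m : ℕ}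
    {E : Fin m → Ω → ℝ} {X : Fin m → Ω → α}
    (hE : ∀ i, HasLaw (E i) (expMeasure (P.real univ)) μ)
    (hX : ∀ i, HasLaw (X i) ((P univ)⁻¹ • P) μ) (hEi : iIndepFun E μ) (hXi : iIndepFun X μ)
    (hEX : IndepFun (fun ω i => E i ω) (fun ω i => X i ω) μ) :
    μ.map (fun ω i => (E i ω, X i ω)) = Measure.pi fun _ : Fin m => stepMeasure P := by
  have := isProbabilityMeasure_expMeasure (real_univ_pos P)
  have hEm : AEMeasurable (fun ω i => E i ω) μ :=
    aemeasurable_pi_lambda _ fun i => (hE i).aemeasurable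
  have hXm : AEMeasurable (fun ω i => X i ω) μ :=
    aemeasurable_pi_lambda _ fun i => (hX i).aemeasurable
  -- Identifies sequences of pairs with pairs of sequences, where the independence of `E` and `X` is
  -- expressed.
  let e := MeasurableEquiv.arrowProdEquivProdArrow ℝ α (Fin m)
  have h1 := (indepFun_iff_map_prod_eq_prod_map_map hEm hXm).1 hEX
  rw [(iIndepFun_iff_map_fun_eq_pi_map fun i => (hE i).aemeasurable).1 hEi,
    (iIndepFun_iff_map_fun_eq_pi_map fun i => (hX i).aemeasurable).1 hXi] at h1
  simp_rw [fun i => (hE i).map_eq, fun i => (hX i).map_eq] at h1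
  have h2 := (measurePreserving_arrowProdEquivProdArrow ℝ α (Fin m)
    (fun _ => expMeasure (P.real univ)) (fun _ => (P univ)⁻¹ • P)).symm
  calc μ.map (fun ω i => (E i ω, X i ω))
      = (μ.map fun ω => (fun i => E i ω, fun i => X i ω)).map e.symm :=
        (AEMeasurable.map_map_of_aemeasurable e.symm.measurable.aemeasurable
          (hEm.prodMk hXm)).symm
    _ = _ := by
        rw [h1]
        exact h2.map_eq

theorem mainTheorem1 {n : ℕ} (P : Measure (EuclideanSpace ℝ (Fin n))) [IsFiniteMeasure P]
    (hP : P ≠ 0)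
    {Ω : Type*} [MeasurableSpace Ω] (μ : Measure Ω) [IsProbabilityMeasure μ]
    (R : Ω → Set (ℝ × EuclideanSpace ℝ (Fin n))) (hR : IsExponentialRace R P μ) :
    -- almost surely the points of `R` can be listed in strictly increasing order of time
    (∀ᵐ ω ∂μ, (∀ i : ℕ, IsArrival (R ω) i (arrival (R ω) i)) ∧
      StrictMono (fun i : ℕ => (arrival (R ω) i).1) ∧ range (arrival (R ω)) = R ω) ∧
    -- and the joint distribution of the first `m` of them is as claimed
    ∀ (m : ℕ) {Ω' : Type*} [MeasurableSpace Ω'] (μ' : Measure Ω') [IsProbabilityMeasure μ']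
      (E : Fin m → Ω' → ℝ) (X : Fin m → Ω' → EuclideanSpace ℝ (Fin n)),
      (∀ i, HasLaw (E i) (expMeasure (P.real univ)) μ') →
      (∀ i, HasLaw (X i) ((P univ)⁻¹ • P) μ') →
      iIndepFun E μ' →
      iIndepFun X μ' →
      IndepFun (fun ω i => E i ω) (fun ω i => X i ω) μ' →
      IdentDistrib (fun ω (i : Fin m) => arrival (R ω) i)
        (fun ω (i : Fin m) => (∑ j ∈ Finset.Iic i, E j ω, X i ω)) μ μ' := by
  have : NeZero P := ⟨hP⟩
  refine ⟨hR.ae_isRaceSet.mono fun ω hω =>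
    ⟨hω.isArrival_arrival, hω.strictMono_arrival, hω.range_arrival⟩, ?_⟩
  intro m Ω' _ μ' _ E X hE hX hEi hXi hEX
  have hm : AEMeasurable (fun ω (i : Fin m) => (E i ω, X i ω)) μ' :=
    aemeasurable_pi_lambda _ fun i => (hE i).aemeasurable.prodMk (hX i).aemeasurable
  refine ⟨aemeasurable_pi_lambda _ fun i => hR.aemeasurable_arrival i,
    measurable_markedSum.comp_aemeasurable hm, ?_⟩
  rw [hR.map_arrival m, ← map_steps_eq_pi hE hX hEi hXi hEX,
    AEMeasurable.map_map_of_aemeasurable measurable_markedSum.aemeasurable hm]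
  rfl
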